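/- Let $d\in\mathbb N$, $\rho>0$, and let $L:\mathbb R\to\mathbb R^{d\times d}$ be locally integrable. For $s\in\mathbb R$ let $\Psi(\cdot,s)$ be the principal matrix solution of $\dot x=L(t)x$ at $s$, i.e. the continuous solution of $\Psi(t,s)=\mathrm{Id}+\int_s^tL(r)\Psi(r,s)\,dr$, $t\in\mathbb R$. Assume that $\dot x=L(t)x$ is exponentially stable: there are $K\ge 1$ and $\gamma>0$ with $\|\Psi(t,s)\|\le Ke^{-\gamma(t-s)}$ for all $t\ge s$ (operator norm induced by the Euclidean norm). Let $\mathcal U=\{\xi\in L^\infty(\mathbb R,\mathbb R^d): \|\xi\|_\infty\le 1\}$. For $M\subset\mathbb R^d$ and $t_0<t$ let $\Phi^{t,t_0}(M)$ be the set of all $x(t)$, where $x$ is a (Carathéodory) solution of $\dot x=L(t)x+\rho\,\xi(t)$ with $x(t_0)\in M$ and $\xi\in\mathcal U$; this is the two-parameter semigroup induced by the differential inclusion $\dot x\in\overline B_\rho(L(t)x)$. A family $\mathcal M=(M_t)_{t\in\mathbb R}$ of nonempty compact subsets of $\mathbb R^d$ is called invariant if $\Phi^{t,t_0}(M_{t_0})=M_t$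 for all $t_0<t$; it is called minimal invariant if, moreover, every invariant family $(S_t)_{t\in\mathbb R}$ with $S_t\subset M_t$ for all $t$ is equal to $\mathcal M$; it is called uniformly bounded if there is $r>0$ with $M_t\subset B_r(0)$ for all $t$. Then the integrals in $$A_t=\Big\{\rho\int_{-\infty}^t\Psi(t,s)\xi(s)\,ds \;:\; \xi\in\mathcal U\Big\},\qquad t\in\mathbb R,$$ converge absolutely, the family $\mathcal A=(A_t)_{t\in\mathbb R}$ is uniformly bounded and minimal invariant, and it is the only uniformly bounded minimal invariant family. Moreover, for every nonempty compact set $C\subset\mathbb R^d$, with $h$ the Hausdorff distance, $$\lim_{t_0\to-\infty}h\big(\Phi^{t,t_0}(C),A_t\big)=0\ \text{ for all }t\in\mathbb R,\qquad \lim_{t\to\infty}h\big(\Phi^{t,t_0}(C),A_t\big)=0\ \text{ for all }t_0\in\mathbb R.$$ -/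

import Mathlib

open MeasureTheory Filter Topology

noncomputable section

namespace LinearInclusion

/-- The Euclidean space `ℝ^d`. -/
abbrev E (d : ℕ) : Type := EuclideanSpace ℝ (Fin d)

/-- Real `d × d` matrices, as linear operators of Euclidean space. The norm is the induced norm
`‖A‖ = sup {|A x| : |x| = 1}`. -/
abbrev Op (d : ℕ) : Type := E d →L[ℝ] E d

variable {d : ℕ}

/-- `X` is the (Carathéodory) solution on `ℝ` of the matrix problem `X' = L(t) X`, `X(s) = Id`. -/
def IsPrincipalSolutionAt (L : ℝ → Op d) (s : ℝ) (X : ℝ → Op d) : Prop :=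
  Continuous X ∧ ∀ t, X t = ContinuousLinearMap.id ℝ (E d) + ∫ r in s..t, (L r).comp (X r)

/-- The principal matrix solution `Ψ(t,s)` of `x' = L(t) x` at `s`. -/
def principalSolution (L : ℝ → Op d) (t s : ℝ) : Op d :=
  Classical.epsilon (fun X : ℝ → Op d => IsPrincipalSolutionAt L s X) t

/-- `x' = L(t) x` is exponentially stable. -/
def ExponentiallyStable (L : ℝ → Op d) : Prop :=
  ∃ K γ : ℝ, 1 ≤ K ∧ 0 < γ ∧
    ∀ s t : ℝ, s ≤ t → ‖principalSolution L t s‖ ≤ K * Real.exp (-γ * (t - s))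

/-- The admissible controls: `ξ ∈ L^∞(ℝ, ℝ^d)` with `‖ξ‖_∞ ≤ 1`. -/
def controls (d : ℕ) : Set (ℝ → E d) :=
  {ξ | MemLp ξ ⊤ volume ∧ eLpNorm ξ ⊤ volume ≤ 1}

/-- `x` is the Carathéodory solution on `ℝ` of `x' = L(t) x + ρ ξ(t)`, `x(t₀) = x₀`. -/
def IsSolution (L : ℝ → Op d) (ρ : ℝ) (ξ : ℝ → E d) (t₀ : ℝ) (x₀ : E d) (x : ℝ → E d) : Prop :=
  Continuous x ∧ ∀ t, x t = x₀ + ∫ r in t₀..t, (L r (x r) + ρ • ξ r)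

/-- The set-valued evolution operator `Φ^{t,t₀}`: all points reached at time `t` from points of
`M` at time `t₀` by solutions of `x' = L(t) x + ρ ξ(t)` for admissible `ξ`. -/
def evolution (L : ℝ → Op d) (ρ t t₀ : ℝ) (M : Set (E d)) : Set (E d) :=
  {y | ∃ x₀ ∈ M, ∃ ξ ∈ controls d, ∃ x : ℝ → E d, IsSolution L ρ ξ t₀ x₀ x ∧ x t = y}

/-- Uniform boundedness of a nonautonomous set `(M_t)`. -/
def UniformlyBounded (M : ℝ → Set (E d)) : Prop :=
  ∃ r : ℝ, 0 < r ∧ ∀ t, M t ⊆ Metric.ball 0 r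

/-- An invariant set: nonempty and compact fibres with `Φ^{t,t₀}(M_{t₀}) = M_t` for `t₀ < t`. -/
def IsInvariant (L : ℝ → Op d) (ρ : ℝ) (M : ℝ → Set (E d)) : Prop :=
  (∀ t, (M t).Nonempty) ∧ (∀ t, IsCompact (M t)) ∧
    ∀ t₀ t : ℝ, t₀ < t → evolution L ρ t t₀ (M t₀) = M t

/-- A minimal invariant set: no proper (nonempty, closed) subset is invariant. -/
def IsMinimalInvariant (L : ℝ → Op d) (ρ : ℝ) (M : ℝ → Set (E d)) : Prop :=
  IsInvariant L ρ M ∧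
    ∀ S : ℝ → Set (E d), IsInvariant L ρ S → (∀ t, S t ⊆ M t) → S = M

/-- `A_t = {ρ ∫_{-∞}^t Ψ(t,s) ξ(s) ds : ‖ξ‖_∞ ≤ 1}`. -/
def attractor (L : ℝ → Op d) (ρ t : ℝ) : Set (E d) :=
  {x | ∃ ξ ∈ controls d, x = ρ • ∫ s in Set.Iic t, principalSolution L t s (ξ s)}

end LinearInclusion

end

/-!
Pairing with the solution `Y = Ψ(t,·)` of the adjoint equation `Y' = -Y L` turns the variation of
constants formula into one application of the product rule for indefinite integrals. It gives
`Φ^{t,t₀}(M) = Ψ(t,t₀) M + R(t,t₀)` with `R(t,t₀) = {ρ ∫_{t₀}^t Ψ(t,s) ξ(s) ds}` independent of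
`M`, so that `h(Φ^{t,t₀}(M), Φ^{t,t₀}(N)) ≤ ‖Ψ(t,t₀)‖ diam (M ∪ N)`. The fibres `A_t` are invariant
because controls can be concatenated at time `t₀`; letting `t₀ → -∞` or `t → ∞` in the estimate
gives attraction, and uniqueness among all uniformly bounded invariant families, hence minimality.

The fibre `A_t` is compact because, with `w = √‖Ψ(t,·)‖`, it is up to the factor `ρ` the image of
the bounded closed convex set `{η ∈ L² : ‖η‖ ≤ w}` under the continuous linear map
`η ↦ ∫ w(s)⁻¹ Ψ(t,s) η(s) ds`, and bounded closed convex subsets of a Hilbert space are weakly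
compact.
-/

noncomputable section

namespace LinearInclusion

section Primitive

variable {F G H : Type*} [NormedAddCommGroup F] [NormedSpace ℝ F] [NormedAddCommGroup G]
  [NormedSpace ℝ G] [NormedAddCommGroup H] [NormedSpace ℝ H] {f u : ℝ → F} {g v : ℝ → G}

/-- `u` is an indefinite integral of `f` on `ℝ`: the integrated form of `u' = f` almost everywhere,
which is how Carathéodory solutions of differential equations are encoded below. -/
structure IsPrimitive (f u : ℝ → F) : Prop where
  intervalIntegrable : ∀ a b, IntervalIntegrable f volume a b
  sub_eq_integral : ∀ a b, u b - u a = ∫ r in a..b, f r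

theorem isPrimitive_of_eq_add_integral (hf : ∀ a b, IntervalIntegrable f volume a b) {s : ℝ}
    {c : F} (hu : ∀ t, u t = c + ∫ r in s..t, f r) : IsPrimitive f u where
  intervalIntegrable := hf
  sub_eq_integral a b := by
    rw [hu a, hu b, add_sub_add_left_eq_sub,
      intervalIntegral.integral_interval_sub_left (hf s b) (hf s a)]

namespace IsPrimitive

theorem eq_add_integral (h : IsPrimitive f u) (s t : ℝ) : u t = u s + ∫ r in s..t, f r := by
  rw [← h.sub_eq_integral s t, add_sub_cancel]

theorem continuous (h : IsPrimitive f u) : Continuous u := by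
  rw [funext (h.eq_add_integral 0)]
  exact continuous_const.add (intervalIntegral.continuous_primitive h.intervalIntegrable 0)

theorem ae_hasDerivAt [CompleteSpace F] (h : IsPrimitive f u) (a b : ℝ) :
    ∀ᵐ x, x ∈ Set.uIcc a b → HasDerivAt u (f x) x := by
  filter_upwards [(h.intervalIntegrable a b).ae_hasDerivAt_integral] with x hx hxab
  rw [funext (h.eq_add_integral a)]
  exact (hx hxab a Set.left_mem_uIcc).const_add _

theorem norm_sub_le (h : IsPrimitive f u) {x y : ℝ} (hxy : x ≤ y) :
    ‖u y - u x‖ ≤ ∫ r in x..y, ‖f r‖ := by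
  rw [h.sub_eq_integral]
  exact intervalIntegral.norm_integral_le_integral_norm hxy

end IsPrimitive

theorem intervalIntegrable_of_locallyIntegrable {F : Type*} [NormedAddCommGroup F] {f : ℝ → F}
    (hf : LocallyIntegrable f volume) (a b : ℝ) : IntervalIntegrable f volume a b :=
  (hf.integrableOn_isCompact isCompact_uIcc).intervalIntegrable

theorem absolutelyContinuousOnInterval_of_norm_sub_le {F : Type*} [NormedAddCommGroup F]
    {w : ℝ → F} {l : ℝ → ℝ} {a b : ℝ} (hl : IntervalIntegrable l volume a b)
    (hw : ∀ x ∈ Set.uIcc a b, ∀ y ∈ Set.uIcc a b, x ≤ y → ‖w y - w x‖ ≤ ∫ r in x..y, l r) :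
    AbsolutelyContinuousOnInterval w a b := by
  have hprim := hl.absolutelyContinuousOnInterval_intervalIntegral Set.left_mem_uIcc
  have hdist : ∀ x ∈ Set.uIcc a b, ∀ y ∈ Set.uIcc a b,
      dist (w x) (w y) ≤ dist (∫ r in a..x, l r) (∫ r in a..y, l r) := by
    intro x hx y hy
    wlog hxy : x ≤ y generalizing x y
    · rw [dist_comm, dist_comm (∫ r in a..x, l r)]
      exact this y hy x hx (le_of_not_ge hxy)
    have hsub {z : ℝ} (hz : z ∈ Set.uIcc a b) : IntervalIntegrable l volume a z :=
      hl.mono_set (Set.uIcc_subset_uIcc Set.left_mem_uIcc hz)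
    rw [dist_comm, dist_comm (∫ r in a..x, l r), dist_eq_norm, Real.dist_eq,
      intervalIntegral.integral_interval_sub_left (hsub hy) (hsub hx)]
    exact (hw x hx y hy hxy).trans (le_abs_self _)
  refine squeeze_zero' (.of_forall fun E => Finset.sum_nonneg fun i _ => dist_nonneg) ?_ hprim
  filter_upwards [mem_inf_of_right (mem_principal_self _)] with E hE
  exact Finset.sum_le_sum fun i hi => hdist _ (hE.1 i hi).1 _ (hE.1 i hi).2

theorem sub_eq_integral_of_ae_hasDerivAt [CompleteSpace F] {w h : ℝ → F} {l : ℝ → ℝ} {a b : ℝ}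
    (hl : IntervalIntegrable l volume a b) (hh : ∀ x y, IntervalIntegrable h volume x y)
    (hw : ∀ x ∈ Set.uIcc a b, ∀ y ∈ Set.uIcc a b, x ≤ y → ‖w y - w x‖ ≤ ∫ r in x..y, l r)
    (hderiv : ∀ᵐ x, x ∈ Set.uIcc a b → HasDerivAt w (h x) x) :
    w b - w a = ∫ r in a..b, h r := by
  have hprim : IsPrimitive h fun x => ∫ r in a..x, h r :=
    isPrimitive_of_eq_add_integral hh fun t => (zero_add _).symm
  have hprim_ac := absolutelyContinuousOnInterval_of_norm_sub_le (hh a b).norm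
    fun x _ y _ => hprim.norm_sub_le
  obtain ⟨c, hc⟩ := ((absolutelyContinuousOnInterval_of_norm_sub_le hl hw).sub
      hprim_ac).const_of_ae_hasDerivAt_zero (by
    filter_upwards [hderiv, hprim.ae_hasDerivAt a b] with x hwx hprimx hx
    simpa using (hwx hx).sub (hprimx hx))
  have hconst := (hc b Set.right_mem_uIcc).trans (hc a Set.left_mem_uIcc).symm
  simp only [Pi.sub_apply, intervalIntegral.integral_same, sub_zero] at hconst
  rw [← hconst, sub_sub_cancel]

theorem intervalIntegrable_bilin_right (B : F →L[ℝ] G →L[ℝ] H) {a b : ℝ}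
    (hf : IntervalIntegrable f volume a b) (hg : Continuous g) :
    IntervalIntegrable (fun r => B (f r) (g r)) volume a b := by
  obtain ⟨C, hC⟩ := (isCompact_uIcc (a := a) (b := b)).exists_bound_of_continuousOn hg.continuousOn
  rw [intervalIntegrable_iff] at hf ⊢
  refine B.integrable_of_bilin_of_bdd_right C hf hg.aestronglyMeasurable ?_
  refine (ae_restrict_iff' measurableSet_uIoc).2 (.of_forall fun r hr => ?_)
  exact hC r (Set.uIoc_subset_uIcc hr)

theorem intervalIntegrable_bilin_left (B : F →L[ℝ] G →L[ℝ] H) {a b : ℝ}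
    (hf : Continuous f) (hg : IntervalIntegrable g volume a b) :
    IntervalIntegrable (fun r => B (f r) (g r)) volume a b :=
  intervalIntegrable_bilin_right B.flip hg hf

theorem IsPrimitive.bilin [CompleteSpace F] [CompleteSpace G] [CompleteSpace H]
    (B : F →L[ℝ] G →L[ℝ] H) (hu : IsPrimitive f u) (hv : IsPrimitive g v) :
    IsPrimitive (fun r => B (u r) (g r) + B (f r) (v r)) fun r => B (u r) (v r) := by
  have hint (a b : ℝ) := (intervalIntegrable_bilin_left B hu.continuous
    (hv.intervalIntegrable a b)).add
      (intervalIntegrable_bilin_right B (hu.intervalIntegrable a b) hv.continuous)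
  refine ⟨hint, fun a b => ?_⟩
  obtain ⟨Cu, hCu⟩ := (isCompact_uIcc (a := a) (b := b)).exists_bound_of_continuousOn
    hu.continuous.continuousOn
  obtain ⟨Cv, hCv⟩ := (isCompact_uIcc (a := a) (b := b)).exists_bound_of_continuousOn
    hv.continuous.continuousOn
  have hCu0 : 0 ≤ Cu := (norm_nonneg _).trans (hCu a Set.left_mem_uIcc)
  refine sub_eq_integral_of_ae_hasDerivAt (w := fun r => B (u r) (v r))
    (((hv.intervalIntegrable a b).norm.const_mul (‖B‖ * Cu)).add
      ((hu.intervalIntegrable a b).norm.const_mul (‖B‖ * Cv))) hint (fun x hx y hy hxy => ?_) ?_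
  · calc ‖B (u y) (v y) - B (u x) (v x)‖
        = ‖B (u y) (v y - v x) + B (u y - u x) (v x)‖ := by
          simp only [map_sub, sub_apply, sub_add_sub_cancel]
      _ ≤ ‖B‖ * ‖u y‖ * ‖v y - v x‖ + ‖B‖ * ‖u y - u x‖ * ‖v x‖ :=
          norm_add_le_of_le (B.le_opNorm₂ _ _) (B.le_opNorm₂ _ _)
      _ ≤ ‖B‖ * Cu * (∫ r in x..y, ‖g r‖) + ‖B‖ * (∫ r in x..y, ‖f r‖) * Cv :=
          add_le_add
            (mul_le_mul (by gcongr; exact hCu y hy) (hv.norm_sub_le hxy) (norm_nonneg _)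
              (by positivity))
            (mul_le_mul (by gcongr; exact hu.norm_sub_le hxy) (hCv x hx) (norm_nonneg _)
              (by have := (norm_nonneg _).trans (hu.norm_sub_le hxy); positivity))
      _ = ∫ r in x..y, (‖B‖ * Cu * ‖g r‖ + ‖B‖ * Cv * ‖f r‖) := by
          rw [intervalIntegral.integral_add ((hv.intervalIntegrable x y).norm.const_mul _)
            ((hu.intervalIntegrable x y).norm.const_mul _), intervalIntegral.integral_const_mul,
            intervalIntegral.integral_const_mul, mul_right_comm ‖B‖ Cv]
  · filter_upwards [hu.ae_hasDerivAt a b, hv.ae_hasDerivAt a b] with x hux hvx hx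
    exact B.hasDerivAt_of_bilinear (fun _ => hux hx) fun _ => hvx hx

theorem intervalIntegrable_clm_apply {A : ℝ → F →L[ℝ] G} {x : ℝ → F} {a b : ℝ}
    (hA : IntervalIntegrable A volume a b) (hx : Continuous x) :
    IntervalIntegrable (fun r => A r (x r)) volume a b :=
  intervalIntegrable_bilin_right (.id ℝ (F →L[ℝ] G)) hA hx

theorem IsPrimitive.clm_apply_const [CompleteSpace G] {A X : ℝ → F →L[ℝ] G}
    (h : IsPrimitive A X) (v : F) : IsPrimitive (fun r => A r v) fun r => X r v where
  intervalIntegrable a b := intervalIntegrable_clm_apply (h.intervalIntegrable a b) continuous_const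
  sub_eq_integral a b := by
    rw [← sub_apply, h.sub_eq_integral]
    exact ContinuousLinearMap.intervalIntegral_apply (h.intervalIntegrable a b) v

end Primitive

section Existence

/-- The weight of the norm in which Picard iteration for `x' = A(t) x + g(t)` with `‖A‖, ‖g‖ ≤ l` is
a contraction. Using `cosh` instead of `exp` (Bielecki) treats both sides of the initial time `s` at
once. -/
def picardWeight (l : ℝ → ℝ) (s t : ℝ) : ℝ := Real.cosh (2 * ∫ r in s..t, l r)

variable {l : ℝ → ℝ}

theorem picardWeight_pos (s t : ℝ) : 0 < picardWeight l s t := Real.cosh_pos _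

theorem continuous_picardWeight (hl : ∀ a b, IntervalIntegrable l volume a b) (s : ℝ) :
    Continuous (picardWeight l s) :=
  Real.continuous_cosh.comp ((intervalIntegral.continuous_primitive hl s).const_mul 2)

theorem abs_integral_mul_picardWeight_le (hl : ∀ a b, IntervalIntegrable l volume a b)
    (hl0 : ∀ r, 0 ≤ l r) (s t : ℝ) :
    |∫ r in s..t, l r * picardWeight l s r| ≤ picardWeight l s t / 2 := by
  set m : ℝ → ℝ := fun t => ∫ r in s..t, l r
  have hm : IsPrimitive l m := isPrimitive_of_eq_add_integral hl fun t => (zero_add _).symm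
  have hmono : Monotone fun r => Real.sinh (2 * m r) / 2 := fun x y hxy => by
    have hxy : m x ≤ m y := by
      rw [← sub_nonneg, hm.sub_eq_integral]
      exact intervalIntegral.integral_nonneg hxy fun r _ => hl0 r
    dsimp only
    gcongr
    exact Real.sinh_le_sinh.2 (by gcongr)
  have hderiv : ∫ r in s..t, deriv (fun r => Real.sinh (2 * m r) / 2) r
      = ∫ r in s..t, l r * picardWeight l s r := by
    refine intervalIntegral.integral_congr_ae ?_
    filter_upwards [hm.ae_hasDerivAt s t] with r hr hrst
    rw [(((hr (Set.uIoc_subset_uIcc hrst)).const_mul 2).sinh.div_const 2).deriv, picardWeight]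
    ring
  have hmem := (hmono.monotoneOn (Set.uIcc s t)).intervalIntegral_deriv_mem_uIcc
  rw [hderiv] at hmem
  calc |∫ r in s..t, l r * picardWeight l s r| ≤ |Real.sinh (2 * m t) / 2| := by
        simpa [m] using Set.abs_sub_left_of_mem_uIcc hmem
    _ ≤ picardWeight l s t / 2 := by
        rw [abs_div, Real.abs_sinh, abs_two, picardWeight, ← Real.cosh_abs]
        gcongr
        exact (Real.sinh_lt_cosh _).le

variable {F : Type*} [NormedAddCommGroup F] [NormedSpace ℝ F]

theorem norm_integral_le_mul_picardWeight (hl : ∀ a b, IntervalIntegrable l volume a b)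
    (hl0 : ∀ r, 0 ≤ l r) {s C : ℝ} (hC : 0 ≤ C) {f : ℝ → F}
    (hf : ∀ r, ‖f r‖ ≤ C * (l r * picardWeight l s r)) (t : ℝ) :
    ‖∫ r in s..t, f r‖ ≤ C / 2 * picardWeight l s t :=
  calc ‖∫ r in s..t, f r‖ ≤ |∫ r in s..t, C * (l r * picardWeight l s r)| :=
        intervalIntegral.norm_integral_le_abs_of_norm_le (.of_forall fun r => hf r)
          (((hl s t).mul_continuousOn (continuous_picardWeight hl s).continuousOn).const_mul C)
    _ ≤ C * (picardWeight l s t / 2) := by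
        rw [intervalIntegral.integral_const_mul, abs_mul, abs_of_nonneg hC]
        gcongr
        exact abs_integral_mul_picardWeight_le hl hl0 s t
    _ = C / 2 * picardWeight l s t := by ring

variable {A : ℝ → F →L[ℝ] F}

theorem norm_integral_apply_picardWeight_smul_le (hl : ∀ a b, IntervalIntegrable l volume a b)
    (hAl : ∀ r, ‖A r‖ ≤ l r) {z : ℝ → F} {C : ℝ} (hz : ∀ r, ‖z r‖ ≤ C) (s t : ℝ) :
    ‖∫ r in s..t, A r (picardWeight l s r • z r)‖ ≤ C / 2 * picardWeight l s t := by
  refine norm_integral_le_mul_picardWeight hl (fun r => (norm_nonneg _).trans (hAl r))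
    ((norm_nonneg _).trans (hz s)) (fun r => ?_) t
  calc ‖A r (picardWeight l s r • z r)‖ ≤ l r * (picardWeight l s r * C) := by
        refine (A r).le_of_opNorm_le_of_le (hAl r) ?_
        rw [norm_smul, Real.norm_of_nonneg (picardWeight_pos s r).le]
        exact mul_le_mul_of_nonneg_left (hz r) (picardWeight_pos s r).le
    _ = C * (l r * picardWeight l s r) := by ring

open BoundedContinuousFunction in
theorem exists_weighted_volterra_operator (hA : ∀ a b, IntervalIntegrable A volume a b)
    (hl : ∀ a b, IntervalIntegrable l volume a b) (hAl : ∀ r, ‖A r‖ ≤ l r) (s : ℝ) :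
    ∃ T : (ℝ →ᵇ F) →L[ℝ] (ℝ →ᵇ F), ‖T‖ ≤ 1 / 2 ∧ ∀ z t, T z t =
      (picardWeight l s t)⁻¹ • ∫ r in s..t, A r (picardWeight l s r • z r) := by
  have hw := continuous_picardWeight hl s
  have hint (z : ℝ →ᵇ F) (a b : ℝ) :
      IntervalIntegrable (fun r => A r (picardWeight l s r • z r)) volume a b :=
    intervalIntegrable_clm_apply (hA a b) (hw.smul z.continuous)
  have hbound (z : ℝ →ᵇ F) (t : ℝ) : ‖(picardWeight l s t)⁻¹ •
      ∫ r in s..t, A r (picardWeight l s r • z r)‖ ≤ 1 / 2 * ‖z‖ := by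
    rw [norm_smul, norm_inv, Real.norm_of_nonneg (picardWeight_pos s t).le,
      inv_mul_le_iff₀ (picardWeight_pos s t)]
    exact (norm_integral_apply_picardWeight_smul_le hl hAl z.norm_coe_le_norm s t).trans_eq
      (by ring)
  let T (z : ℝ →ᵇ F) : ℝ →ᵇ F := .ofNormedAddCommGroup _
    ((hw.inv₀ fun t => (picardWeight_pos s t).ne').smul
      (intervalIntegral.continuous_primitive (hint z) s)) _ (hbound z)
  have hT (z : ℝ →ᵇ F) (t : ℝ) : T z t =
      (picardWeight l s t)⁻¹ • ∫ r in s..t, A r (picardWeight l s r • z r) := rfl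
  refine ⟨LinearMap.mkContinuous ⟨⟨T, fun z₁ z₂ => ?_⟩, fun c z => ?_⟩ (1 / 2) fun z => ?_,
    LinearMap.mkContinuous_norm_le _ (by norm_num) _, hT⟩
  · ext t
    simp only [hT, BoundedContinuousFunction.add_apply, smul_add, map_add,
      intervalIntegral.integral_add (hint z₁ s t) (hint z₂ s t)]
  · ext t
    simp only [hT, BoundedContinuousFunction.smul_apply, smul_comm _ c, map_smul,
      intervalIntegral.integral_smul, RingHom.id_apply]
  · exact (norm_le (by positivity)).2 (hbound z)

open BoundedContinuousFunction in
theorem exists_volterra_solution [CompleteSpace F] (hA : ∀ a b, IntervalIntegrable A volume a b)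
    (hl : ∀ a b, IntervalIntegrable l volume a b) (hAl : ∀ r, ‖A r‖ ≤ l r) {s C : ℝ} {p : ℝ → F}
    (hp : Continuous p) (hpC : ∀ t, ‖p t‖ ≤ C * picardWeight l s t) :
    ∃ x : ℝ → F, Continuous x ∧ ∀ t, x t = p t + ∫ r in s..t, A r (x r) := by
  have hw := continuous_picardWeight hl s
  have hw0 (t : ℝ) : picardWeight l s t ≠ 0 := (picardWeight_pos s t).ne'
  obtain ⟨T, hT, hTapply⟩ := exists_weighted_volterra_operator hA hl hAl s
  let q : ℝ →ᵇ F := .ofNormedAddCommGroup (fun t => (picardWeight l s t)⁻¹ • p t)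
    ((hw.inv₀ hw0).smul hp) C fun t => by
      rw [norm_smul, norm_inv, Real.norm_of_nonneg (picardWeight_pos s t).le,
        inv_mul_le_iff₀ (picardWeight_pos s t), mul_comm]
      exact hpC t
  obtain ⟨z, hz⟩ : ∃ z, z - T z = q := by
    obtain ⟨u, hu⟩ := isUnit_one_sub_of_norm_lt_one (hT.trans_lt one_half_lt_one)
    refine ⟨(↑u⁻¹ : (ℝ →ᵇ F) →L[ℝ] (ℝ →ᵇ F)) q, ?_⟩
    have h := congr($(u.mul_inv) q)
    rwa [hu] at h
  refine ⟨fun t => picardWeight l s t • z t, hw.smul z.continuous, fun t => ?_⟩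
  calc picardWeight l s t • z t
      = picardWeight l s t • ((picardWeight l s t)⁻¹ • p t + T z t) := by
        rw [sub_eq_iff_eq_add.1 congr($hz t)]; rfl
    _ = p t + ∫ r in s..t, A r (picardWeight l s r • z r) := by
        rw [hTapply, smul_add, smul_inv_smul₀ (hw0 t), smul_inv_smul₀ (hw0 t)]

theorem exists_caratheodory_solution [CompleteSpace F] {g : ℝ → F}
    (hA : ∀ a b, IntervalIntegrable A volume a b) (hg : ∀ a b, IntervalIntegrable g volume a b)
    (s : ℝ) (x₀ : F) : ∃ x : ℝ → F, x s = x₀ ∧ IsPrimitive (fun r => A r (x r) + g r) x := by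
  set l : ℝ → ℝ := fun r => ‖A r‖ + ‖g r‖
  have hl (a b : ℝ) : IntervalIntegrable l volume a b := (hA a b).norm.add (hg a b).norm
  have hw1 (r : ℝ) : 1 ≤ picardWeight l s r := Real.one_le_cosh _
  have hl0 (r : ℝ) : 0 ≤ l r := by positivity
  have hp : Continuous fun t => x₀ + ∫ r in s..t, g r :=
    continuous_const.add (intervalIntegral.continuous_primitive hg s)
  have hpC (t : ℝ) : ‖x₀ + ∫ r in s..t, g r‖ ≤ (‖x₀‖ + 1 / 2) * picardWeight l s t := by
    rw [add_mul]
    refine norm_add_le_of_le (le_mul_of_one_le_right (norm_nonneg _) (hw1 t))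
      (norm_integral_le_mul_picardWeight hl hl0 zero_le_one (fun r => ?_) t)
    rw [one_mul]
    exact (le_add_of_nonneg_left (norm_nonneg _)).trans (le_mul_of_one_le_right (hl0 r) (hw1 r))
  obtain ⟨x, hx, hxt⟩ := exists_volterra_solution hA hl
    (fun r => le_add_of_nonneg_right (norm_nonneg _)) hp hpC
  have hAx (a b : ℝ) := intervalIntegrable_clm_apply (hA a b) hx
  refine ⟨x, by simp [hxt s], isPrimitive_of_eq_add_integral (fun a b => (hAx a b).add (hg a b))
    (s := s) (c := x₀) fun t => ?_⟩
  rw [intervalIntegral.integral_add (hAx s t) (hg s t), add_comm (∫ r in s..t, A r _),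
    ← add_assoc, ← hxt]

end Existence

section Resolvent

variable {V : Type*} [NormedAddCommGroup V] [NormedSpace ℝ V] {A Y : ℝ → V →L[ℝ] V} {x g : ℝ → V}

-- Pairing with a solution of the adjoint equation `Y' = -Y A` removes `A` from `x' = A x + g`.
theorem IsPrimitive.adjoint_apply [CompleteSpace V]
    (hY : IsPrimitive (fun r => -(Y r).comp (A r)) Y)
    (hx : IsPrimitive (fun r => A r (x r) + g r) x) :
    IsPrimitive (fun r => Y r (g r)) fun r => Y r (x r) := by
  have h := IsPrimitive.bilin (.id ℝ (V →L[ℝ] V)) hY hx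
  simpa using h

theorem exists_isPrimitive_comp_left [CompleteSpace V]
    (hA : ∀ a b, IntervalIntegrable A volume a b) (s : ℝ) :
    ∃ X : ℝ → V →L[ℝ] V, X s = .id ℝ V ∧ IsPrimitive (fun r => (A r).comp (X r)) X := by
  obtain ⟨X, hXs, hX⟩ := exists_caratheodory_solution (g := 0)
    (fun a b => ⟨(ContinuousLinearMap.compL ℝ V V V).integrable_comp (hA a b).1,
      (ContinuousLinearMap.compL ℝ V V V).integrable_comp (hA a b).2⟩)
    (fun a b => intervalIntegrable_const) s (.id ℝ V)
  exact ⟨X, hXs, by simpa using hX⟩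

theorem exists_isPrimitive_neg_comp_right [CompleteSpace V]
    (hA : ∀ a b, IntervalIntegrable A volume a b) (t : ℝ) :
    ∃ Y : ℝ → V →L[ℝ] V, Y t = .id ℝ V ∧ IsPrimitive (fun r => -(Y r).comp (A r)) Y := by
  obtain ⟨Y, hYt, hY⟩ := exists_caratheodory_solution (g := 0)
    (fun a b => ⟨(-(ContinuousLinearMap.compL ℝ V V V).flip).integrable_comp (hA a b).1,
      (-(ContinuousLinearMap.compL ℝ V V V).flip).integrable_comp (hA a b).2⟩)
    (fun a b => intervalIntegrable_const) t (.id ℝ V)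
  exact ⟨Y, hYt, by simpa using hY⟩

variable {d : ℕ} {L : ℝ → Op d}

theorem isPrincipalSolutionAt_principalSolution (hL : LocallyIntegrable L volume) (s : ℝ) :
    IsPrincipalSolutionAt L s fun t => principalSolution L t s := by
  obtain ⟨X, hXs, hX⟩ :=
    exists_isPrimitive_comp_left (fun a b => intervalIntegrable_of_locallyIntegrable hL a b) s
  exact Classical.epsilon_spec (p := IsPrincipalSolutionAt L s)
    ⟨X, hX.continuous, fun t => hXs ▸ hX.eq_add_integral s t⟩

theorem principalSolution_self (hL : LocallyIntegrable L volume) (s : ℝ) :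
    principalSolution L s s = .id ℝ (E d) := by
  simpa using (isPrincipalSolutionAt_principalSolution hL s).2 s

theorem isPrimitive_principalSolution_left (hL : LocallyIntegrable L volume) (s : ℝ) :
    IsPrimitive (fun r => (L r).comp (principalSolution L r s)) fun t => principalSolution L t s :=
  have h := isPrincipalSolutionAt_principalSolution hL s
  isPrimitive_of_eq_add_integral (fun a b => intervalIntegrable_bilin_right
    (.compL ℝ (E d) (E d) (E d)) (intervalIntegrable_of_locallyIntegrable hL a b) h.1) h.2

theorem isPrimitive_principalSolution_apply (hL : LocallyIntegrable L volume) (s : ℝ) (v : E d) :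
    IsPrimitive (fun r => L r (principalSolution L r s v) + 0)
      fun t => principalSolution L t s v := by
  simpa using (isPrimitive_principalSolution_left hL s).clm_apply_const v

theorem isPrimitive_principalSolution_right (hL : LocallyIntegrable L volume) (t : ℝ) :
    IsPrimitive (fun s => -(principalSolution L t s).comp (L s)) (principalSolution L t) := by
  obtain ⟨Y, hYt, hY⟩ := exists_isPrimitive_neg_comp_right
    (fun a b => intervalIntegrable_of_locallyIntegrable hL a b) t
  suffices principalSolution L t = Y by rwa [this]
  funext s
  ext1 v
  have h := (hY.adjoint_apply (isPrimitive_principalSolution_apply hL s v)).sub_eq_integral s t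
  simpa [hYt, principalSolution_self hL, sub_eq_zero] using h

theorem continuous_principalSolution_right (hL : LocallyIntegrable L volume) (t : ℝ) :
    Continuous (principalSolution L t) :=
  (isPrimitive_principalSolution_right hL t).continuous

theorem eq_principalSolution_apply_add_integral (hL : LocallyIntegrable L volume) {x g : ℝ → E d}
    (hx : IsPrimitive (fun r => L r (x r) + g r) x) (s t : ℝ) :
    x t = principalSolution L t s (x s) + ∫ r in s..t, principalSolution L t r (g r) := by
  have h := ((isPrimitive_principalSolution_right hL t).adjoint_apply hx).eq_add_integral s t
  rwa [principalSolution_self hL] at h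

theorem principalSolution_apply_principalSolution (hL : LocallyIntegrable L volume) (t s r : ℝ)
    (v : E d) :
    principalSolution L t s (principalSolution L s r v) = principalSolution L t r v := by
  have h := isPrimitive_principalSolution_apply hL r v
  simpa using (eq_principalSolution_apply_add_integral hL h s t).symm

end Resolvent

section Evolution

variable {d : ℕ} {L : ℝ → Op d} {ρ t t₀ : ℝ}

theorem mem_controls_iff {ξ : ℝ → E d} :
    ξ ∈ controls d ↔ AEStronglyMeasurable ξ volume ∧ ∀ᵐ s, ‖ξ s‖ ≤ 1 := by
  constructor
  · rintro ⟨hξ, hle⟩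
    refine ⟨hξ.1, ?_⟩
    rw [eLpNorm_exponent_top] at hle
    filter_upwards [ae_le_eLpNormEssSup (f := ξ) (μ := volume)] with s hs
    have h := hs.trans hle
    rwa [← ofReal_norm, ENNReal.ofReal_le_one] at h
  · rintro ⟨hξ, hle⟩
    refine ⟨memLp_top_of_bound hξ 1 hle, ?_⟩
    rw [eLpNorm_exponent_top]
    simpa using eLpNormEssSup_le_of_ae_bound hle

theorem isSolution_iff (hL : LocallyIntegrable L volume) {ξ : ℝ → E d}
    (hξ : ∀ a b, IntervalIntegrable ξ volume a b) {x₀ : E d} {x : ℝ → E d} :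
    IsSolution L ρ ξ t₀ x₀ x ↔ x t₀ = x₀ ∧ IsPrimitive (fun r => L r (x r) + ρ • ξ r) x := by
  refine ⟨fun ⟨hx, hxt⟩ => ⟨by simp [hxt t₀], isPrimitive_of_eq_add_integral (fun a b => ?_) hxt⟩,
    fun ⟨hx₀, hx⟩ => ⟨hx.continuous, fun t => hx₀ ▸ hx.eq_add_integral t₀ t⟩⟩
  exact (intervalIntegrable_clm_apply (intervalIntegrable_of_locallyIntegrable hL a b) hx).add
    ((hξ a b).smul ρ)

theorem mem_evolution_iff (hL : LocallyIntegrable L volume) {M : Set (E d)} {y : E d} :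
    y ∈ evolution L ρ t t₀ M ↔ ∃ x₀ ∈ M, ∃ ξ ∈ controls d,
      principalSolution L t t₀ x₀ + ρ • ∫ s in t₀..t, principalSolution L t s (ξ s) = y := by
  refine exists_congr fun x₀ => and_congr_right fun _ => exists_congr fun ξ =>
    and_congr_right fun hξ => ?_
  have hξ' := intervalIntegrable_of_locallyIntegrable (hξ.1.locallyIntegrable le_top)
  have hvar {x : ℝ → E d} (hx : IsSolution L ρ ξ t₀ x₀ x) : x t =
      principalSolution L t t₀ x₀ + ρ • ∫ s in t₀..t, principalSolution L t s (ξ s) := by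
    obtain ⟨hx₀, hx⟩ := (isSolution_iff hL hξ').1 hx
    rw [eq_principalSolution_apply_add_integral hL hx t₀ t, hx₀]
    simp only [map_smul, intervalIntegral.integral_smul]
  constructor
  · rintro ⟨x, hx, rfl⟩
    exact (hvar hx).symm
  · rintro rfl
    obtain ⟨x, hx⟩ := exists_caratheodory_solution (intervalIntegrable_of_locallyIntegrable hL)
      (fun a b => (hξ' a b).smul ρ) t₀ x₀
    have hx := (isSolution_iff hL hξ').2 hx
    exact ⟨x, hx, hvar hx⟩

end Evolution

section Compactness

theorem inclusionInDoubleDual_surjective (H : Type*) [NormedAddCommGroup H]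
    [InnerProductSpace ℝ H] [CompleteSpace H] :
    Function.Surjective (NormedSpace.inclusionInDoubleDual ℝ H) := by
  intro φ
  obtain ⟨x, hx⟩ := (InnerProductSpace.toDual ℝ H).surjective (φ.comp (innerSL ℝ : H →L[ℝ] _))
  refine ⟨x, ContinuousLinearMap.ext fun f => ?_⟩
  obtain ⟨y, rfl⟩ := (InnerProductSpace.toDual ℝ H).surjective f
  calc InnerProductSpace.toDual ℝ H y x = InnerProductSpace.toDual ℝ H x y := by
        simp [real_inner_comm]
    _ = φ (InnerProductSpace.toDual ℝ H y) := by rw [hx]; rfl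

theorem isCompact_toWeakSpace_image {H : Type*} [NormedAddCommGroup H] [InnerProductSpace ℝ H]
    [CompleteSpace H] {C : Set H} (hconv : Convex ℝ C) (hclosed : IsClosed C)
    (hbdd : Bornology.IsBounded C) : IsCompact (toWeakSpace ℝ H '' C) := by
  have hsurj : Function.Surjective (NormedSpace.inclusionInDoubleDualWeak ℝ H) := fun φ => by
    obtain ⟨x, hx⟩ := inclusionInDoubleDual_surjective H (WeakDual.toStrongDual φ)
    exact ⟨toWeakSpace ℝ H x, congrArg StrongDual.toWeakDual hx⟩
  rw [← hclosed.closure_eq, hconv.toWeakSpace_closure ℝ]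
  refine NormedSpace.isCompact_closure_of_isBounded ℝ H _ ?_ fun φ _ => hsurj φ
  rwa [Set.preimage_image_eq _ (toWeakSpace ℝ H).injective]

theorem isClosed_image_of_convex {H F : Type*} [NormedAddCommGroup H] [InnerProductSpace ℝ H]
    [CompleteSpace H] [NormedAddCommGroup F] [NormedSpace ℝ F] (T : H →L[ℝ] F) {C : Set H}
    (hconv : Convex ℝ C) (hclosed : IsClosed C) (hbdd : Bornology.IsBounded C) :
    IsClosed (T '' C) := by
  have hweak : IsClosed (WeakSpace.map T '' (toWeakSpace ℝ H '' C)) :=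
    ((isCompact_toWeakSpace_image hconv hclosed hbdd).image (WeakSpace.map T).continuous).isClosed
  have heq : T '' C = toWeakSpaceCLM ℝ F ⁻¹' (WeakSpace.map T '' (toWeakSpace ℝ H '' C)) := by
    rw [Set.image_image]
    exact (Set.preimage_image_eq (T '' C) (toWeakSpace ℝ F).injective).symm.trans
      (by rw [Set.image_image]; rfl)
  rw [heq]
  exact hweak.preimage (toWeakSpaceCLM ℝ F).continuous

variable {α V F : Type*} [MeasurableSpace α] {μ : Measure α} [NormedAddCommGroup V]

theorem isClosed_setOf_ae_norm_le (w : α → ℝ) :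
    IsClosed {η : Lp V 2 μ | ∀ᵐ s ∂μ, ‖η s‖ ≤ w s} := by
  refine IsSeqClosed.isClosed fun u η hu hη => ?_
  obtain ⟨φ, -, hφ⟩ := (tendstoInMeasure_of_tendsto_Lp hη).exists_seq_tendsto_ae
  filter_upwards [hφ, ae_all_iff.2 hu] with s hs hle
  exact le_of_tendsto hs.norm (.of_forall fun n => hle _)

theorem convex_setOf_ae_norm_le [NormedSpace ℝ V] (w : α → ℝ) :
    Convex ℝ {η : Lp V 2 μ | ∀ᵐ s ∂μ, ‖η s‖ ≤ w s} := by
  intro η hη ζ hζ a b ha hb hab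
  filter_upwards [hη, hζ, Lp.coeFn_add (a • η) (b • ζ), Lp.coeFn_smul a η, Lp.coeFn_smul b ζ]
    with s hηs hζs hadd hsmul₁ hsmul₂
  rw [hadd, Pi.add_apply, hsmul₁, hsmul₂, ← mem_closedBall_zero_iff]
  exact convex_closedBall (0 : V) (w s) (mem_closedBall_zero_iff.2 hηs)
    (mem_closedBall_zero_iff.2 hζs) ha hb hab

theorem isBounded_setOf_ae_norm_le {w : α → ℝ} (hw : MemLp w 2 μ) :
    Bornology.IsBounded {η : Lp V 2 μ | ∀ᵐ s ∂μ, ‖η s‖ ≤ w s} := by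
  refine isBounded_iff_forall_norm_le.2 ⟨‖hw.toLp w‖, fun η hη => Lp.norm_le_norm_of_ae_le ?_⟩
  filter_upwards [hη, hw.coeFn_toLp] with s hle hs
  rw [hs]
  exact hle.trans (le_abs_self _)

variable [InnerProductSpace ℝ V] [CompleteSpace V] [NormedAddCommGroup F] [NormedSpace ℝ F]
  [FiniteDimensional ℝ F] {κ : α → V →L[ℝ] F}

theorem isCompact_setOf_integral_of_memLp_two {w : α → ℝ} (hκ : MemLp κ 2 μ) (hw : MemLp w 2 μ) :
    IsCompact {x : F | ∃ η : α → V, AEStronglyMeasurable η μ ∧ (∀ᵐ s ∂μ, ‖η s‖ ≤ w s) ∧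
      x = ∫ s, κ s (η s) ∂μ} := by
  have : CompleteSpace F := FiniteDimensional.complete ℝ F
  have : ProperSpace F := FiniteDimensional.proper ℝ F
  let T : Lp V 2 μ →L[ℝ] F :=
    (ContinuousLinearMap.id ℝ (V →L[ℝ] F)).lpPairing μ 2 2 (hκ.toLp κ)
  have hT {η : Lp V 2 μ} {ζ : α → V} (h : η =ᵐ[μ] ζ) : T η = ∫ s, κ s (ζ s) ∂μ := by
    simp only [T, ContinuousLinearMap.lpPairing_eq_integral]
    refine integral_congr_ae ?_
    filter_upwards [h, hκ.coeFn_toLp] with s hηs hκs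
    rw [hηs, hκs]
    rfl
  have heq : {x : F | ∃ η : α → V, AEStronglyMeasurable η μ ∧ (∀ᵐ s ∂μ, ‖η s‖ ≤ w s) ∧
      x = ∫ s, κ s (η s) ∂μ} = T '' {η : Lp V 2 μ | ∀ᵐ s ∂μ, ‖η s‖ ≤ w s} := by
    ext x
    constructor
    · rintro ⟨η, hm, hle, rfl⟩
      have hη : MemLp η 2 μ := hw.of_le hm (hle.mono fun s hs => hs.trans (le_abs_self _))
      refine ⟨hη.toLp η, ?_, hT hη.coeFn_toLp⟩
      filter_upwards [hη.coeFn_toLp, hle] with s hs hles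
      rwa [hs]
    · rintro ⟨η, hle, rfl⟩
      exact ⟨η, Lp.aestronglyMeasurable η, hle, hT EventuallyEq.rfl⟩
  rw [heq]
  exact Metric.isCompact_of_isClosed_isBounded
    (isClosed_image_of_convex T (convex_setOf_ae_norm_le w) (isClosed_setOf_ae_norm_le w)
      (isBounded_setOf_ae_norm_le hw))
    (T.lipschitz.isBounded_image (isBounded_setOf_ae_norm_le hw))

theorem isCompact_setOf_integral (hκ : Integrable κ μ) :
    IsCompact {x : F | ∃ ξ : α → V, AEStronglyMeasurable ξ μ ∧ (∀ᵐ s ∂μ, ‖ξ s‖ ≤ 1) ∧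
      x = ∫ s, κ s (ξ s) ∂μ} := by
  -- `κ ξ = (w⁻¹ κ) (w ξ)` for `w = √‖κ‖`, where `w` and `‖w⁻¹ κ‖ = w` are square integrable.
  let w : α → ℝ := fun s => √‖κ s‖
  have hwκ (s : α) (v : V) : w s • (w s)⁻¹ • κ s v = κ s v := by
    rcases eq_or_ne (κ s) 0 with h | h
    · simp [h]
    · exact smul_inv_smul₀ (Real.sqrt_ne_zero'.2 (norm_pos_iff.2 h)) _
  have hwm : AEStronglyMeasurable w μ :=
    Real.continuous_sqrt.comp_aestronglyMeasurable hκ.aestronglyMeasurable.norm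
  have hwinv : AEStronglyMeasurable (fun s => (w s)⁻¹) μ :=
    hwm.aemeasurable.inv.aestronglyMeasurable
  have hw : MemLp w 2 μ := (memLp_two_iff_integrable_sq hwm).2
    (hκ.norm.congr (.of_forall fun s => (Real.sq_sqrt (norm_nonneg _)).symm))
  have hκw : MemLp (fun s => (w s)⁻¹ • κ s) 2 μ :=
    hw.of_le (hwinv.smul hκ.aestronglyMeasurable) <| .of_forall fun s => by
      rw [norm_smul, norm_inv, Real.norm_of_nonneg (Real.sqrt_nonneg _), inv_mul_eq_div,
        Real.div_sqrt]
  convert isCompact_setOf_integral_of_memLp_two hκw hw using 1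
  ext x
  constructor
  · rintro ⟨ξ, hm, hle, rfl⟩
    refine ⟨fun s => w s • ξ s, hwm.smul hm, ?_, ?_⟩
    · filter_upwards [hle] with s hs
      rw [norm_smul, Real.norm_of_nonneg (Real.sqrt_nonneg _)]
      exact mul_le_of_le_one_right (Real.sqrt_nonneg _) hs
    · simp only [smul_apply, map_smul, hwκ]
  · rintro ⟨η, hm, hle, rfl⟩
    refine ⟨fun s => (w s)⁻¹ • η s, hwinv.smul hm, ?_, ?_⟩
    · filter_upwards [hle] with s hs
      rw [norm_smul, norm_inv, Real.norm_of_nonneg (Real.sqrt_nonneg _)]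
      exact inv_mul_le_one_of_le₀ hs (Real.sqrt_nonneg _)
    · simp only [smul_apply, map_smul]

end Compactness

section Stability

variable {d : ℕ} {L : ℝ → Op d}

/-- The consequences of exponential stability on which attraction rests: `Ψ(t,·)` is integrable on
`(-∞,t]` with a bound uniform in `t`, and `Ψ(t,s)` tends to zero as `s → -∞` and as `t → ∞`. -/
structure IsIntegrablyStable (L : ℝ → Op d) : Prop where
  integrableOn : ∀ t, IntegrableOn (principalSolution L t) (Set.Iic t)
  exists_integral_norm_le : ∃ C, ∀ t, ∫ s in Set.Iic t, ‖principalSolution L t s‖ ≤ C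
  tendsto_atBot : ∀ t, Tendsto (fun s => principalSolution L t s) atBot (𝓝 0)
  tendsto_atTop : ∀ s, Tendsto (fun t => principalSolution L t s) atTop (𝓝 0)

theorem exp_neg_mul_sub (γ t s : ℝ) :
    Real.exp (-γ * (t - s)) = Real.exp (-γ * t) * Real.exp (γ * s) := by
  rw [← Real.exp_add]; ring_nf

theorem integrableOn_exp_neg_mul_sub {γ : ℝ} (hγ : 0 < γ) (t : ℝ) :
    IntegrableOn (fun s => Real.exp (-γ * (t - s))) (Set.Iic t) := by
  simp_rw [exp_neg_mul_sub γ t]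
  exact (integrableOn_exp_mul_Iic hγ t).const_mul _

theorem integral_exp_neg_mul_sub {γ : ℝ} (hγ : 0 < γ) (t : ℝ) :
    ∫ s in Set.Iic t, Real.exp (-γ * (t - s)) = 1 / γ := by
  simp_rw [exp_neg_mul_sub γ t]
  rw [integral_const_mul, integral_exp_mul_Iic hγ, ← mul_div_assoc, ← Real.exp_add]
  simp

theorem tendsto_const_mul_exp_neg_mul {ι : Type*} {l : Filter ι} {u : ι → ℝ} {γ : ℝ} (hγ : 0 < γ)
    (hu : Tendsto u l atTop) (K : ℝ) :
    Tendsto (fun i => K * Real.exp (-γ * u i)) l (𝓝 0) := by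
  simpa using (Real.tendsto_exp_atBot.comp
    (hu.const_mul_atTop_of_neg (neg_neg_of_pos hγ))).const_mul K

theorem ExponentiallyStable.isIntegrablyStable (hL : LocallyIntegrable L volume)
    (hstab : ExponentiallyStable L) : IsIntegrablyStable L := by
  obtain ⟨K, γ, -, hγ, hK⟩ := hstab
  have hexp (t : ℝ) : IntegrableOn (fun s => K * Real.exp (-γ * (t - s))) (Set.Iic t) :=
    (integrableOn_exp_neg_mul_sub hγ t).const_mul K
  have hint (t : ℝ) : IntegrableOn (principalSolution L t) (Set.Iic t) :=
    (hexp t).mono' (continuous_principalSolution_right hL t).aestronglyMeasurable <| by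
      filter_upwards [ae_restrict_mem measurableSet_Iic] with s hs using hK s t hs
  refine ⟨hint, ⟨K * (1 / γ), fun t => ?_⟩, fun t => ?_, fun s => ?_⟩
  · rw [← integral_exp_neg_mul_sub hγ t, ← integral_const_mul]
    exact setIntegral_mono_on (hint t).norm (hexp t) measurableSet_Iic fun s hs => hK s t hs
  · refine squeeze_zero_norm' ?_ (tendsto_const_mul_exp_neg_mul hγ
      (tendsto_atTop_add_const_left atBot t tendsto_neg_atBot_atTop) K)
    filter_upwards [eventually_le_atBot t] with s hs using hK s t hs
  · refine squeeze_zero_norm' ?_ (tendsto_const_mul_exp_neg_mul hγ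
      (tendsto_atTop_add_const_right atTop (-s) tendsto_id) K)
    filter_upwards [eventually_ge_atTop s] with t ht using hK s t ht

end Stability

section Attractor

variable {d : ℕ} {L : ℝ → Op d} {ρ t t₀ : ℝ} {ξ ζ : ℝ → E d}

theorem zero_mem_controls : (0 : ℝ → E d) ∈ controls d :=
  mem_controls_iff.2 ⟨aestronglyMeasurable_zero, by simp⟩

theorem piecewise_mem_controls {A : Set ℝ} [DecidablePred (· ∈ A)] (hA : MeasurableSet A)
    (hξ : ξ ∈ controls d) (hζ : ζ ∈ controls d) : A.piecewise ξ ζ ∈ controls d := by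
  rw [mem_controls_iff] at hξ hζ ⊢
  refine ⟨hξ.1.restrict.piecewise hA hζ.1.restrict, ?_⟩
  filter_upwards [hξ.2, hζ.2] with s hξs hζs
  by_cases hs : s ∈ A <;> simp [hs, hξs, hζs]

theorem exists_controls_eqOn {A : Set ℝ} (hA : MeasurableSet A)
    (hm : AEStronglyMeasurable ξ (volume.restrict A))
    (hle : ∀ᵐ s ∂(volume.restrict A), ‖ξ s‖ ≤ 1) : ∃ ζ ∈ controls d, Set.EqOn ξ ζ A := by
  refine ⟨A.indicator ξ, mem_controls_iff.2 ⟨(aestronglyMeasurable_indicator_iff hA).2 hm, ?_⟩,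
    fun s hs => (Set.indicator_of_mem hs ξ).symm⟩
  filter_upwards [(ae_restrict_iff' hA).1 hle] with s hs
  by_cases hsA : s ∈ A
  · simpa [hsA] using hs hsA
  · simp [hsA]

theorem ae_norm_apply_le_of_mem_controls {F : Type*} [NormedAddCommGroup F] [NormedSpace ℝ F]
    (κ : ℝ → E d →L[ℝ] F) (hξ : ξ ∈ controls d) : ∀ᵐ s, ‖κ s (ξ s)‖ ≤ ‖κ s‖ := by
  filter_upwards [(mem_controls_iff.1 hξ).2] with s hs
  exact (κ s).unit_le_opNorm _ hs

theorem integrableOn_principalSolution_apply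
    (hint : IntegrableOn (principalSolution L t) (Set.Iic t)) (hξ : ξ ∈ controls d) :
    IntegrableOn (fun s => principalSolution L t s (ξ s)) (Set.Iic t) :=
  hint.norm.mono'
    ((ContinuousLinearMap.id ℝ (Op d)).aestronglyMeasurable_comp₂ hint.aestronglyMeasurable
      (mem_controls_iff.1 hξ).1.restrict)
    (ae_restrict_of_ae (ae_norm_apply_le_of_mem_controls _ hξ))

theorem norm_le_of_mem_attractor (hint : IntegrableOn (principalSolution L t) (Set.Iic t))
    {x : E d} (hx : x ∈ attractor L ρ t) :
    ‖x‖ ≤ |ρ| * ∫ s in Set.Iic t, ‖principalSolution L t s‖ := by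
  obtain ⟨ξ, hξ, rfl⟩ := hx
  rw [norm_smul, Real.norm_eq_abs]
  gcongr
  exact norm_integral_le_of_norm_le hint.norm
    (ae_restrict_of_ae (ae_norm_apply_le_of_mem_controls _ hξ))

theorem attractor_nonempty : (attractor L ρ t).Nonempty := ⟨_, 0, zero_mem_controls, rfl⟩

theorem isCompact_attractor (hint : IntegrableOn (principalSolution L t) (Set.Iic t)) :
    IsCompact (attractor L ρ t) := by
  have heq : attractor L ρ t = (ρ • ·) '' {x : E d | ∃ ξ : ℝ → E d,
      AEStronglyMeasurable ξ (volume.restrict (Set.Iic t)) ∧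
      (∀ᵐ s ∂(volume.restrict (Set.Iic t)), ‖ξ s‖ ≤ 1) ∧
      x = ∫ s in Set.Iic t, principalSolution L t s (ξ s)} := by
    ext x
    constructor
    · rintro ⟨ξ, hξ, rfl⟩
      obtain ⟨hm, hle⟩ := mem_controls_iff.1 hξ
      exact ⟨_, ⟨ξ, hm.restrict, ae_restrict_of_ae hle, rfl⟩, rfl⟩
    · rintro ⟨_, ⟨ξ, hm, hle, rfl⟩, rfl⟩
      obtain ⟨ζ, hζ, hξζ⟩ := exists_controls_eqOn measurableSet_Iic hm hle
      exact ⟨ζ, hζ, congrArg (ρ • ·) <| setIntegral_congr_fun measurableSet_Iic fun s hs =>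
        congrArg (principalSolution L t s) (hξζ hs)⟩
  rw [heq]
  exact (isCompact_setOf_integral hint).image (continuous_const_smul ρ)

theorem setIntegral_Iic_principalSolution_split (hL : LocallyIntegrable L volume)
    (hint : ∀ t, IntegrableOn (principalSolution L t) (Set.Iic t)) (hξ : ξ ∈ controls d)
    (ht : t₀ ≤ t) :
    ∫ s in Set.Iic t, principalSolution L t s (ξ s)
      = principalSolution L t t₀ (∫ s in Set.Iic t₀, principalSolution L t₀ s (ξ s))
        + ∫ s in t₀..t, principalSolution L t s (ξ s) := by
  have hi := integrableOn_principalSolution_apply (hint t) hξ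
  rw [← intervalIntegral.integral_Iic_sub_Iic (hi.mono_set (Set.Iic_subset_Iic.2 ht)) hi,
    ← ContinuousLinearMap.integral_comp_comm _
      (integrableOn_principalSolution_apply (hint t₀) hξ)]
  simp only [principalSolution_apply_principalSolution hL, add_sub_cancel]

theorem evolution_attractor (hL : LocallyIntegrable L volume)
    (hint : ∀ t, IntegrableOn (principalSolution L t) (Set.Iic t)) (ht : t₀ ≤ t) :
    evolution L ρ t t₀ (attractor L ρ t₀) = attractor L ρ t := by
  classical
  ext y
  rw [mem_evolution_iff hL]
  constructor
  · rintro ⟨_, ⟨ξ, hξ, rfl⟩, ζ, hζ, rfl⟩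
    have hc := piecewise_mem_controls (measurableSet_Iic (a := t₀)) hξ hζ
    refine ⟨_, hc, ?_⟩
    rw [setIntegral_Iic_principalSolution_split hL hint hc ht, map_smul, ← smul_add]
    congr 2
    · congr 1
      refine setIntegral_congr_fun measurableSet_Iic fun s hs => ?_
      rw [Set.piecewise_eq_of_mem _ _ _ hs]
    · rw [intervalIntegral.integral_of_le ht, intervalIntegral.integral_of_le ht]
      refine setIntegral_congr_fun measurableSet_Ioc fun s hs => ?_
      rw [Set.piecewise_eq_of_notMem _ _ _ (Set.notMem_Iic.2 hs.1)]
  · rintro ⟨ξ, hξ, rfl⟩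
    refine ⟨_, ⟨ξ, hξ, rfl⟩, ξ, hξ, ?_⟩
    rw [setIntegral_Iic_principalSolution_split hL hint hξ ht, map_smul, ← smul_add]

theorem IsIntegrablyStable.uniformlyBounded_attractor (hstab : IsIntegrablyStable L) (ρ : ℝ) :
    UniformlyBounded (attractor L ρ) := by
  obtain ⟨C, hC⟩ := hstab.exists_integral_norm_le
  refine ⟨max 0 (|ρ| * C) + 1, by positivity, fun t x hx => mem_ball_zero_iff.2 ?_⟩
  calc ‖x‖ ≤ |ρ| * ∫ s in Set.Iic t, ‖principalSolution L t s‖ :=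
        norm_le_of_mem_attractor (hstab.integrableOn t) hx
    _ ≤ |ρ| * C := by gcongr; exact hC t
    _ < max 0 (|ρ| * C) + 1 := (le_max_right _ _).trans_lt (lt_add_one _)

theorem IsIntegrablyStable.isInvariant_attractor (hL : LocallyIntegrable L volume)
    (hstab : IsIntegrablyStable L) (ρ : ℝ) : IsInvariant L ρ (attractor L ρ) :=
  ⟨fun _ => attractor_nonempty, fun t => isCompact_attractor (hstab.integrableOn t),
    fun _ _ ht => evolution_attractor hL hstab.integrableOn ht.le⟩

end Attractor

section Attraction

variable {d : ℕ} {L : ℝ → Op d} {ρ : ℝ}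

theorem exists_mem_evolution_edist_le (hL : LocallyIntegrable L volume) {t t₀ : ℝ}
    {M N B : Set (E d)} (hMB : M ⊆ B) (hN : N.Nonempty) (hNB : N ⊆ B) {y : E d}
    (hy : y ∈ evolution L ρ t t₀ M) :
    ∃ z ∈ evolution L ρ t t₀ N, edist y z ≤ ‖principalSolution L t t₀‖ₑ * Metric.ediam B := by
  obtain ⟨x, hx, ξ, hξ, rfl⟩ := (mem_evolution_iff hL).1 hy
  obtain ⟨x', hx'⟩ := hN
  refine ⟨_, (mem_evolution_iff hL).2 ⟨x', hx', ξ, hξ, rfl⟩, ?_⟩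
  rw [edist_add_right]
  calc edist (principalSolution L t t₀ x) (principalSolution L t t₀ x')
      ≤ ‖principalSolution L t t₀‖ₑ * edist x x' := (principalSolution L t t₀).lipschitz x x'
    _ ≤ _ := by gcongr; exact Metric.edist_le_ediam_of_mem (hMB hx) (hNB hx')

theorem hausdorffEDist_evolution_le (hL : LocallyIntegrable L volume) (t t₀ : ℝ) {M N B : Set (E d)}
    (hM : M.Nonempty) (hN : N.Nonempty) (hMB : M ⊆ B) (hNB : N ⊆ B) :
    Metric.hausdorffEDist (evolution L ρ t t₀ M) (evolution L ρ t t₀ N) ≤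
      ‖principalSolution L t t₀‖ₑ * Metric.ediam B :=
  Metric.hausdorffEDist_le_of_mem_edist
    (fun _ hy => exists_mem_evolution_edist_le hL hMB hN hNB hy)
    (fun _ hy => exists_mem_evolution_edist_le hL hNB hM hMB hy)

theorem tendsto_hausdorffEDist_evolution (hL : LocallyIntegrable L volume) {ι : Type*}
    {l : Filter ι} {t t₀ : ι → ℝ}
    (hΨ : Tendsto (fun i => principalSolution L (t i) (t₀ i)) l (𝓝 0)) {M N : ι → Set (E d)}
    (hM : ∀ i, (M i).Nonempty) (hN : ∀ i, (N i).Nonempty) {B : Set (E d)}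
    (hB : Bornology.IsBounded B) (hMB : ∀ i, M i ⊆ B) (hNB : ∀ i, N i ⊆ B) :
    Tendsto (fun i => Metric.hausdorffEDist (evolution L ρ (t i) (t₀ i) (M i))
      (evolution L ρ (t i) (t₀ i) (N i))) l (𝓝 0) := by
  have hnorm : Tendsto (fun i => ‖principalSolution L (t i) (t₀ i)‖ₑ) l (𝓝 0) := by
    simpa only [norm_zero, ENNReal.ofReal_zero, ofReal_norm] using
      ENNReal.tendsto_ofReal hΨ.norm
  have hlim : Tendsto (fun i => ‖principalSolution L (t i) (t₀ i)‖ₑ * Metric.ediam B) l (𝓝 0) := by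
    simpa only [zero_mul] using ENNReal.Tendsto.mul_const hnorm (.inr hB.ediam_ne_top)
  exact tendsto_of_tendsto_of_tendsto_of_le_of_le tendsto_const_nhds hlim (fun _ => zero_le)
    fun i => hausdorffEDist_evolution_le hL (t i) (t₀ i) (hM i) (hN i) (hMB i) (hNB i)

theorem UniformlyBounded.mono {M N : ℝ → Set (E d)} (hN : UniformlyBounded N)
    (hMN : ∀ t, M t ⊆ N t) : UniformlyBounded M :=
  let ⟨r, hr₀, hr⟩ := hN
  ⟨r, hr₀, fun t => (hMN t).trans (hr t)⟩

theorem UniformlyBounded.exists_isBounded {M : ℝ → Set (E d)} (hM : UniformlyBounded M) :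
    ∃ B : Set (E d), Bornology.IsBounded B ∧ ∀ t, M t ⊆ B :=
  let ⟨r, _, hr⟩ := hM
  ⟨Metric.ball 0 r, Metric.isBounded_ball, hr⟩

theorem IsIntegrablyStable.eq_of_isInvariant (hL : LocallyIntegrable L volume)
    (hstab : IsIntegrablyStable L) {M N : ℝ → Set (E d)} (hM : IsInvariant L ρ M)
    (hN : IsInvariant L ρ N) (hMb : UniformlyBounded M) (hNb : UniformlyBounded N) : M = N := by
  obtain ⟨B, hB, hMB⟩ := hMb.exists_isBounded
  obtain ⟨B', hB', hNB'⟩ := hNb.exists_isBounded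
  funext t
  refine ((hM.2.1 t).isClosed.hausdorffEDist_zero_iff (hN.2.1 t).isClosed).1 ?_
  have hlim := tendsto_hausdorffEDist_evolution (ρ := ρ) hL (hstab.tendsto_atBot t) hM.1 hN.1
    (hB.union hB') (fun s => (hMB s).trans Set.subset_union_left)
    (fun s => (hNB' s).trans Set.subset_union_right)
  refine tendsto_nhds_unique (tendsto_const_nhds.congr' ?_) hlim
  filter_upwards [eventually_lt_atBot t] with t₀ ht
  rw [hM.2.2 t₀ t ht, hN.2.2 t₀ t ht]

theorem IsIntegrablyStable.tendsto_hausdorffEDist_attractor (hL : LocallyIntegrable L volume)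
    (hstab : IsIntegrablyStable L) {ι : Type*} {l : Filter ι} {t t₀ : ι → ℝ}
    (ht : ∀ᶠ i in l, t₀ i ≤ t i)
    (hΨ : Tendsto (fun i => principalSolution L (t i) (t₀ i)) l (𝓝 0)) {C : Set (E d)}
    (hC : Bornology.IsBounded C) (hne : C.Nonempty) :
    Tendsto (fun i => Metric.hausdorffEDist (evolution L ρ (t i) (t₀ i) C)
      (attractor L ρ (t i))) l (𝓝 0) := by
  obtain ⟨B, hB, hAB⟩ := (hstab.uniformlyBounded_attractor ρ).exists_isBounded
  refine (tendsto_hausdorffEDist_evolution (ρ := ρ) hL hΨ (fun _ => hne)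
    (fun i => attractor_nonempty (t := t₀ i)) (hC.union hB)
    (fun _ => Set.subset_union_left) (fun i => (hAB (t₀ i)).trans Set.subset_union_right)).congr' ?_
  filter_upwards [ht] with i hi
  rw [evolution_attractor hL hstab.integrableOn hi]

end Attraction

end LinearInclusion

end

open LinearInclusion in
theorem theorem4p2_general {d : ℕ} {L : ℝ → Op d} (hL : LocallyIntegrable L volume) (ρ : ℝ)
    (hstab : IsIntegrablyStable L) :
    (∀ t, ∀ ξ ∈ controls d, IntegrableOn (fun s => principalSolution L t s (ξ s)) (Set.Iic t)) ∧
    UniformlyBounded (attractor L ρ) ∧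
    IsMinimalInvariant L ρ (attractor L ρ) ∧
    (∀ M : ℝ → Set (E d), UniformlyBounded M → IsInvariant L ρ M → M = attractor L ρ) ∧
    ∀ C : Set (E d), Bornology.IsBounded C → C.Nonempty →
      (∀ t, Tendsto (fun t₀ => Metric.hausdorffEDist (evolution L ρ t t₀ C) (attractor L ρ t))
        atBot (𝓝 0)) ∧
      ∀ t₀, Tendsto (fun t => Metric.hausdorffEDist (evolution L ρ t t₀ C) (attractor L ρ t))
        atTop (𝓝 0) := by
  have hbdd := hstab.uniformlyBounded_attractor ρ
  have hinv := hstab.isInvariant_attractor hL ρ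
  have huniq (M : ℝ → Set (E d)) (hMb : UniformlyBounded M) (hM : IsInvariant L ρ M) :
      M = attractor L ρ := hstab.eq_of_isInvariant hL hM hinv hMb hbdd
  refine ⟨fun t ξ hξ => integrableOn_principalSolution_apply (hstab.integrableOn t) hξ, hbdd,
    ⟨hinv, fun S hS hSA => huniq S (hbdd.mono hSA) hS⟩, huniq,
    fun C hC hne => ⟨fun t => ?_, fun t₀ => ?_⟩⟩
  · exact hstab.tendsto_hausdorffEDist_attractor hL (eventually_le_atBot t)
      (hstab.tendsto_atBot t) hC hne
  · exact hstab.tendsto_hausdorffEDist_attractor hL (eventually_ge_atTop t₀)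
      (hstab.tendsto_atTop t₀) hC hne

theorem theorem4p2 (d : ℕ) (L : ℝ → LinearInclusion.Op d) (hL : LocallyIntegrable L volume)
    (ρ : ℝ) (hρ : 0 < ρ) (hstab : LinearInclusion.ExponentiallyStable L) :
    -- the integrals that define the fibres converge
    (∀ t : ℝ, ∀ ξ ∈ LinearInclusion.controls d,
      IntegrableOn (fun s => LinearInclusion.principalSolution L t s (ξ s)) (Set.Iic t) volume) ∧
    LinearInclusion.UniformlyBounded (LinearInclusion.attractor L ρ) ∧
    LinearInclusion.IsMinimalInvariant L ρ (LinearInclusion.attractor L ρ) ∧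
    -- uniqueness
    (∀ M : ℝ → Set (LinearInclusion.E d), LinearInclusion.UniformlyBounded M →
      LinearInclusion.IsMinimalInvariant L ρ M → M = LinearInclusion.attractor L ρ) ∧
    -- pullback and forward attraction
    (∀ K : Set (LinearInclusion.E d), IsCompact K → K.Nonempty →
      (∀ t : ℝ, Tendsto (fun t₀ => Metric.hausdorffEDist (LinearInclusion.evolution L ρ t t₀ K)
        (LinearInclusion.attractor L ρ t)) atBot (𝓝 0)) ∧
      (∀ t₀ : ℝ, Tendsto (fun t => Metric.hausdorffEDist (LinearInclusion.evolution L ρ t t₀ K)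
        (LinearInclusion.attractor L ρ t)) atTop (𝓝 0))) := by
  obtain ⟨hint, hbdd, hmin, huniq, hattr⟩ :=
    theorem4p2_general hL ρ (hstab.isIntegrablyStable hL)
  exact ⟨hint, hbdd, hmin, fun M hMb hM => huniq M hMb hM.1,
    fun K hK hne => hattr K hK.isBounded hne⟩
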